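/- Let $\Gamma\subseteq\mathbb{R}^n$ be a lattice (a discrete subgroup), let $E$ be a finite list of elements of $\Gamma$ (repetitions and zero vectors allowed), and for $A\subseteq E$ let $\mathcal{Z}(A)=\{\sum_{e\in A}\lambda_e e: 0\le\lambda_e\le 1\}$ be the zonotope of the sublist $A$. For any lattice $\Lambda$ in a space $\mathbb{R}^d$ and any finite list $F$ of elements of $\Lambda$, let $\mathbf{Ehr}_F(\Lambda;\underline{x})\in\mathbb{Q}[x_f: f\in F]$ be the multivariate Ehrhart polynomial of $F$, that is, the unique polynomial with $\mathbf{Ehr}_F(\Lambda;\underline{k})=|\mathcal{Z}(\{k_f f: f\in F\})\cap\Lambda|$ for all families $\underline{k}=(k_f)_{f\in F}$ of positive integers; for a polytope $\mathcal{P}$ with vertices in $\Lambda$, let $\mathrm{Ehr}_{\mathcal{P}}(\Lambda;x)\in\mathbb{Q}[x]$ be its Ehrhart polynomial, that is, the unique polynomial with $\mathrm{Ehr}_{\mathcal{P}}(\Lambda;k)=|k\mathcal{P}\cap\Lambda|$ for all positive integers $k$. For $A\subseteq E$, let $U_{|E\setminus A|}$ be the standard basis of $\mathbb{R}^{E\setminus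 A}$ and $\square_{|E\setminus A|}=[0,1]^{E\setminus A}$ the unit cube. Then all the polynomials occurring below exist, and for all families $\underline{p}=(p_e)_{e\in E}$ and $\underline{v}=(v_e)_{e\in E}$ of elements of a commutative $\mathbb{Q}$-algebra (for instance real numbers, or indeterminates), $$\mathbf{Ehr}_E(\Gamma;(p_ev_e)_{e\in E})=\sum_{A\subseteq E}\Big(\prod_{e\in A}p_e\Big)\cdot\mathbf{Ehr}_A(\Gamma;(v_e)_{e\in A})\cdot\mathbf{Ehr}_{U_{|E\setminus A|}}(\mathbb{Z}^{E\setminus A};(-p_e)_{e\in E\setminus A}).$$ In particular, for all elements $p,t$ of a commutative $\mathbb{Q}$-algebra, $$\mathrm{Ehr}_{\mathcal{Z}(E)}(\Gamma;pt)=\sum_{A\subseteq E}p^{|A|}\cdot\mathrm{Ehr}_{\mathcal{Z}(A)}(\Gamma;t)\cdot\mathrm{Ehr}_{\square_{|E\setminus A|}}(\mathbb{Z}^{E\setminus A};-p).$$ Here $A\subseteq E$ runs over the sublists of $E$, that is, over the subsets of its index set. -/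

import Mathlib

open scoped Pointwise

/-- The zonotope `{∑ i, l i • e i : 0 ≤ l i ≤ 1}` of a finite list (family) `e` of vectors. -/
def zonotope {V : Type*} [AddCommGroup V] [Module ℝ V] {ι : Type*} [Fintype ι]
    (e : ι → V) : Set V :=
  {x | ∃ l : ι → ℝ, (∀ i, 0 ≤ l i ∧ l i ≤ 1) ∧ x = ∑ i, l i • e i}

/-- `f` is an Ehrhart polynomial of the set `P` with respect to `Γ`: for every positive
integer `k`, the set `kP ∩ Γ` is finite and `f k` is its number of elements. -/
def IsEhrhart {V : Type*} [AddCommGroup V] [Module ℝ V] (Γ : Submodule ℤ V) (P : Set V)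
    (f : Polynomial ℚ) : Prop :=
  ∀ k : ℕ, 0 < k →
    ((k : ℝ) • P ∩ (Γ : Set V)).Finite ∧
      f.eval (k : ℚ) = (((k : ℝ) • P ∩ (Γ : Set V)).ncard : ℚ)

/-- `f` is a multivariate Ehrhart polynomial of the list `e` with respect to `Γ`: for all
positive integers `k i`, the zonotope of the list of the `k i • e i` contains finitely many
points of `Γ`, and `f k` is their number. -/
def IsMultivariateEhrhart {V : Type*} [AddCommGroup V] [Module ℝ V] {ι : Type*} [Fintype ι]
    (Γ : Submodule ℤ V) (e : ι → V) (f : MvPolynomial ι ℚ) : Prop :=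
  ∀ k : ι → ℕ, (∀ i, 0 < k i) →
    (zonotope (fun i => k i • e i) ∩ (Γ : Set V)).Finite ∧
      MvPolynomial.eval (fun i => (k i : ℚ)) f =
        ((zonotope (fun i => k i • e i) ∩ (Γ : Set V)).ncard : ℚ)

theorem IsEhrhart.unique {V : Type*} [AddCommGroup V] [Module ℝ V] {Γ : Submodule ℤ V}
    {P : Set V} {f g : Polynomial ℚ} (hf : IsEhrhart Γ P f) (hg : IsEhrhart Γ P g) : f = g := by
  refine Polynomial.eq_of_infinite_eval_eq f g ?_
  refine Set.Infinite.mono (s := Set.range (fun k : ℕ => ((k + 1 : ℕ) : ℚ))) ?_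
    (Set.infinite_range_of_injective ?_)
  · rintro _ ⟨k, rfl⟩
    exact (hf _ k.succ_pos).2.trans (hg _ k.succ_pos).2.symm
  · intro a b h
    simpa using h

theorem IsMultivariateEhrhart.unique {V : Type*} [AddCommGroup V] [Module ℝ V] {ι : Type*}
    [Fintype ι] {Γ : Submodule ℤ V} {e : ι → V} {f g : MvPolynomial ι ℚ}
    (hf : IsMultivariateEhrhart Γ e f) (hg : IsMultivariateEhrhart Γ e g) : f = g := by
  refine MvPolynomial.funext_set (fun _ => Set.range (fun k : ℕ => ((k + 1 : ℕ) : ℚ)))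
    (fun _ => Set.infinite_range_of_injective ?_) ?_
  · intro a b h
    simpa using h
  · intro x hx
    have hx' : ∀ i, ∃ k : ℕ, ((k + 1 : ℕ) : ℚ) = x i := fun i => hx i (Set.mem_univ i)
    choose k hk using hx'
    obtain rfl : (fun i => ((k i + 1 : ℕ) : ℚ)) = x := funext hk
    exact (hf (fun i => k i + 1) fun i => (k i).succ_pos).2.trans
      (hg (fun i => k i + 1) fun i => (k i).succ_pos).2.symm

open Classical in
/-- The Ehrhart polynomial of `P` with respect to `Γ` (unique when it exists, `0` otherwise). -/
noncomputable def ehrhart {V : Type*} [AddCommGroup V] [Module ℝ V] (Γ : Submodule ℤ V)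
    (P : Set V) : Polynomial ℚ :=
  if h : ∃ f, IsEhrhart Γ P f then h.choose else 0

open Classical in
/-- The multivariate Ehrhart polynomial of the list `e` with respect to `Γ` (unique when it
exists, `0` otherwise). -/
noncomputable def multivariateEhrhart {V : Type*} [AddCommGroup V] [Module ℝ V] {ι : Type*}
    [Fintype ι] (Γ : Submodule ℤ V) (e : ι → V) : MvPolynomial ι ℚ :=
  if h : ∃ f, IsMultivariateEhrhart Γ e f then h.choose else 0

/-- The standard basis of `ℝ^κ`, as a list. -/
noncomputable def stdList (κ : Type*) [Fintype κ] [DecidableEq κ] : κ → (κ → ℝ) :=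
  fun i => Pi.single i 1

/-- The lattice `ℤ^κ` in `ℝ^κ`. -/
noncomputable def intLattice (κ : Type*) [Fintype κ] [DecidableEq κ] : Submodule ℤ (κ → ℝ) :=
  Submodule.span ℤ (Set.range (stdList κ))

/-- The unit cube `[0,1]^κ` in `ℝ^κ`. -/
def unitCube (κ : Type*) : Set (κ → ℝ) :=
  {x | ∀ i, 0 ≤ x i ∧ x i ≤ 1}

/-- The sublist of `e` with index set `A`. -/
def sublist {V ι : Type*} (e : ι → V) (A : Finset ι) : A → V :=
  fun i => e i

/-! ### Zonotopes and the layers of one generator. -/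

section Zonotope

variable {V : Type*} [AddCommGroup V] [Module ℝ V] {ι : Type*} [Fintype ι]

/-! The number of lattice points is affine in each multiplicity `k i`: raising `k i` by one adds a
layer, and all these layers are translates of each other by multiples of the lattice vector `e i`
(`zonotope_update_succ_diff`, by convexity). So the Ehrhart polynomial `f` has degree at most one in
every variable and interpolates the counts on `{0,1}^ι`. The formula then holds for every such `f`:
since `p i * v i` is the affine combination of `v i` and `0` with weights `p i` and `1 - p i`,
expanding in all variables gives a sum over `A` (`aeval_mul_cubeInterpolation`). Setting the
variables off `A` to zero deletes those generators, and `∏ (1 - p i)` is the cube polynomial `∏ (1 +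
X i)` at `-p`. -/

theorem convex_zonotope (e : ι → V) : Convex ℝ (zonotope e) := by
  rintro _ ⟨l, hl, rfl⟩ _ ⟨l', hl', rfl⟩ a b ha hb hab
  refine ⟨fun i => a * l i + b * l' i, fun i => ⟨?_, ?_⟩, ?_⟩
  · have := (hl i).1
    have := (hl' i).1
    positivity
  · have h1 := mul_le_mul_of_nonneg_left (hl i).2 ha
    have h2 := mul_le_mul_of_nonneg_left (hl' i).2 hb
    linarith
  · simp only [Finset.smul_sum, ← Finset.sum_add_distrib, add_smul, mul_smul]

theorem isCompact_zonotope {V : Type*} [NormedAddCommGroup V] [NormedSpace ℝ V] (e : ι → V) :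
    IsCompact (zonotope e) := by
  have h : zonotope e =
      (fun l : ι → ℝ => ∑ i, l i • e i) '' Set.univ.pi fun _ => Set.Icc (0 : ℝ) 1 := by
    ext x
    constructor
    · rintro ⟨l, hl, rfl⟩
      exact ⟨l, fun i _ => hl i, rfl⟩
    · rintro ⟨l, hl, rfl⟩
      exact ⟨l, fun i => hl i (Set.mem_univ i), rfl⟩
  rw [h]
  exact (isCompact_univ_pi fun _ => isCompact_Icc).image (by fun_prop)

theorem mem_zonotope_nsmul {e : ι → V} {k : ι → ℕ} {x : V} :
    x ∈ zonotope (fun i => k i • e i) ↔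
      ∃ l : ι → ℝ, (∀ i, 0 ≤ l i ∧ l i ≤ k i) ∧ x = ∑ i, l i • e i := by
  constructor
  · rintro ⟨l, hl, rfl⟩
    refine ⟨fun i => l i * k i, fun i => ⟨?_, ?_⟩, ?_⟩
    · have := (hl i).1
      positivity
    · exact mul_le_of_le_one_left (Nat.cast_nonneg _) (hl i).2
    · simp only [mul_smul, Nat.cast_smul_eq_nsmul]
  · rintro ⟨l, hl, rfl⟩
    refine ⟨fun i => l i / k i, fun i => ⟨?_, ?_⟩, ?_⟩
    · have := (hl i).1
      positivity
    · exact div_le_one_of_le₀ (hl i).2 (Nat.cast_nonneg _)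
    · refine Finset.sum_congr rfl fun i _ => ?_
      dsimp only
      rw [← Nat.cast_smul_eq_nsmul ℝ, smul_smul]
      -- If `k i = 0`, division gives the default value `0`, which is correct because the bounds
      -- force `l i = 0`.
      rcases Nat.eq_zero_or_pos (k i) with h | h
      · have h1 := hl i
        rw [h, Nat.cast_zero] at h1
        simp [h, le_antisymm h1.2 h1.1]
      · rw [div_mul_cancel₀]
        positivity

theorem smul_zonotope (e : ι → V) (k : ℕ) :
    (k : ℝ) • zonotope e = zonotope (fun i => k • e i) := by
  ext x
  simp only [Set.mem_smul_set]
  constructor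
  · rintro ⟨_, ⟨l, hl, rfl⟩, rfl⟩
    refine ⟨l, hl, ?_⟩
    simp only [Finset.smul_sum, ← Nat.cast_smul_eq_nsmul ℝ, smul_comm (k : ℝ)]
  · rintro ⟨l, hl, rfl⟩
    refine ⟨_, ⟨l, hl, rfl⟩, ?_⟩
    simp only [Finset.smul_sum, ← Nat.cast_smul_eq_nsmul ℝ, smul_comm (k : ℝ)]

theorem mem_zonotope_update [DecidableEq ι] {e : ι → V} {k : ι → ℕ} {i : ι} {m : ℕ} {x : V} :
    x ∈ zonotope (fun j => Function.update k i m j • e j) ↔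
      ∃ z ∈ zonotope (fun j => Function.update k i 0 j • e j), ∃ s : ℝ,
        0 ≤ s ∧ s ≤ m ∧ x = z + s • e i := by
  simp only [mem_zonotope_nsmul]
  constructor
  · rintro ⟨l, hl, rfl⟩
    refine ⟨_, ⟨Function.update l i 0, fun j => ?_, rfl⟩, l i, (hl i).1, by simpa using (hl i).2, ?_⟩
    · rcases eq_or_ne j i with rfl | h
      · simp
      · simpa [h] using hl j
    · rw [← Finset.add_sum_erase _ _ (Finset.mem_univ i),
        ← Finset.add_sum_erase (a := i) _ (fun j => Function.update l i 0 j • e j)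
          (Finset.mem_univ i), Function.update_self, zero_smul, zero_add, add_comm]
      congr 1
      refine Finset.sum_congr rfl fun j hj => ?_
      rw [Function.update_of_ne (Finset.ne_of_mem_erase hj)]
  · rintro ⟨_, ⟨l, hl, rfl⟩, s, hs0, hs, rfl⟩
    have hi := hl i
    simp only [Function.update_self, Nat.cast_zero] at hi
    have hi0 : l i = 0 := le_antisymm hi.2 hi.1
    refine ⟨Function.update l i s, fun j => ?_, ?_⟩
    · rcases eq_or_ne j i with rfl | h
      · simp [hs0, hs]
      · simpa [h] using hl j
    · rw [← Finset.add_sum_erase _ _ (Finset.mem_univ i),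
        ← Finset.add_sum_erase (a := i) _ (fun j => Function.update l i s j • e j)
          (Finset.mem_univ i), Function.update_self, hi0, zero_smul, zero_add, add_comm]
      congr 1
      refine Finset.sum_congr rfl fun j hj => ?_
      rw [Function.update_of_ne (Finset.ne_of_mem_erase hj)]

theorem zonotope_update_mono [DecidableEq ι] (e : ι → V) (k : ι → ℕ) (i : ι) {m m' : ℕ}
    (h : m ≤ m') :
    zonotope (fun j => Function.update k i m j • e j) ⊆
      zonotope (fun j => Function.update k i m' j • e j) := by
  intro x hx
  obtain ⟨z, hz, s, hs0, hs, rfl⟩ := mem_zonotope_update.1 hx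
  exact mem_zonotope_update.2 ⟨z, hz, s, hs0, hs.trans (by exact_mod_cast h), rfl⟩

/-- The layers by which a zonotope grows when one generator is lengthened are translates of
each other. -/
theorem zonotope_update_succ_diff [DecidableEq ι] (Γ : Submodule ℤ V) {e : ι → V} {i : ι}
    (hi : e i ∈ Γ) (k : ι → ℕ) (m : ℕ) :
    (zonotope (fun j => Function.update k i (m + 1) j • e j) ∩ (Γ : Set V)) \
        (zonotope (fun j => Function.update k i m j • e j) ∩ (Γ : Set V)) =
      (fun y => y + m • e i) ''
        ((zonotope (fun j => Function.update k i 1 j • e j) ∩ (Γ : Set V)) \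
          (zonotope (fun j => Function.update k i 0 j • e j) ∩ (Γ : Set V))) := by
  have hmi : m • e i ∈ Γ := nsmul_mem hi m
  ext x
  constructor
  · rintro ⟨⟨hx, hxΓ⟩, hx'⟩
    have hx' : x ∉ zonotope (fun j => Function.update k i m j • e j) := fun h => hx' ⟨h, hxΓ⟩
    obtain ⟨z, hz, s, hs0, hs, rfl⟩ := mem_zonotope_update.1 hx
    have hms : (m : ℝ) < s := by
      by_contra! h
      exact hx' (mem_zonotope_update.2 ⟨z, hz, s, hs0, h, rfl⟩)
    refine ⟨z + s • e i - m • e i, ⟨⟨mem_zonotope_update.2 ⟨z, hz, s - m, by linarith, ?_, ?_⟩,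
      Γ.sub_mem hxΓ hmi⟩, fun h => hx' (mem_zonotope_update.2 ⟨_, h.1, m, ?_, le_rfl, ?_⟩)⟩, ?_⟩
    · push_cast at hs ⊢
      linarith
    · rw [sub_smul, Nat.cast_smul_eq_nsmul]
      abel
    · positivity
    · rw [Nat.cast_smul_eq_nsmul]
      abel
    · simp
  · rintro ⟨y, ⟨⟨hy, hyΓ⟩, hy'⟩, rfl⟩
    have hy' : y ∉ zonotope (fun j => Function.update k i 0 j • e j) := fun h => hy' ⟨h, hyΓ⟩
    obtain ⟨z, hz, s, hs0, hs, rfl⟩ := mem_zonotope_update.1 hy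
    refine ⟨⟨mem_zonotope_update.2 ⟨z, hz, s + m, by positivity, ?_, ?_⟩, Γ.add_mem hyΓ hmi⟩,
      fun h => hy' ?_⟩
    · push_cast at hs ⊢
      linarith
    · rw [add_smul, Nat.cast_smul_eq_nsmul, ← add_assoc]
    -- If the translate of `y` were in the old zonotope, then `y = z + s • e i` would lie on the
    -- segment from `z` to `z'`, hence in the convex base zonotope.
    · obtain ⟨z', hz', r, hr0, hr, h⟩ := mem_zonotope_update.1 h.1
      have hz'e : z' = z + (s + (m - r)) • e i := by
        rw [← sub_eq_iff_eq_add.2 h, add_smul, sub_smul, Nat.cast_smul_eq_nsmul]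
        simp only [add_sub_assoc, add_assoc]
      -- For `s = 0` the denominator `s + (m - r)` may vanish, but then `y = z`.
      rcases hs0.eq_or_lt with rfl | hs0
      · simpa using hz
      · have hpos : 0 < s + (m - r) := by linarith
        have := convex_zonotope (fun j => Function.update k i 0 j • e j) hz hz'
          (a := (m - r) / (s + (m - r))) (b := s / (s + (m - r)))
          (div_nonneg (by linarith) hpos.le) (by positivity) (by field_simp; ring)
        convert this using 1
        rw [hz'e, smul_add, smul_smul, ← add_assoc, ← add_smul, ← add_div,
          add_comm ((m : ℝ) - r) s, div_self hpos.ne', one_smul, div_mul_cancel₀ _ hpos.ne']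

theorem zonotope_extend {A : Finset ι} [DecidableEq ι] (e : ι → V) (k : A → ℕ) :
    zonotope (fun i => (if h : i ∈ A then k ⟨i, h⟩ else 0) • e i) =
      zonotope (fun i => k i • sublist e A i) := by
  ext x
  simp only [mem_zonotope_nsmul]
  constructor
  · rintro ⟨l, hl, rfl⟩
    refine ⟨fun i => l i, fun i => by simpa using hl i, ?_⟩
    refine (Finset.sum_subset (Finset.subset_univ A) ?_).symm.trans
      (Finset.sum_coe_sort A fun i => l i • e i).symm
    · intro i _ hi
      have := hl i
      simp only [hi, dite_false, Nat.cast_zero] at this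
      rw [le_antisymm this.2 this.1, zero_smul]
  · rintro ⟨l, hl, rfl⟩
    refine ⟨fun i => if h : i ∈ A then l ⟨i, h⟩ else 0, fun i => ?_, ?_⟩
    · by_cases h : i ∈ A
      · simpa [h] using hl ⟨i, h⟩
      · simp [h]
    · rw [← Finset.sum_subset (Finset.subset_univ A)
        (f := fun i => (if h : i ∈ A then l ⟨i, h⟩ else 0) • e i) fun i _ hi => by simp [hi],
        ← Finset.sum_coe_sort A fun i => (if h : i ∈ A then l ⟨i, h⟩ else 0) • e i]
      exact Finset.sum_congr rfl fun i _ => by simp [sublist]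

theorem sum_smul_stdList {κ : Type*} [Fintype κ] [DecidableEq κ] (l : κ → ℝ) :
    ∑ i, l i • stdList κ i = l := by
  ext j
  simp [stdList, Finset.sum_apply, Pi.single_apply]

theorem zonotope_stdList (κ : Type*) [Fintype κ] [DecidableEq κ] :
    zonotope (stdList κ) = unitCube κ := by
  ext x
  constructor
  · rintro ⟨l, hl, rfl⟩
    rw [sum_smul_stdList]
    exact hl
  · intro hx
    exact ⟨x, hx, (sum_smul_stdList x).symm⟩

end Zonotope

/-! ### Counting lattice points. -/

section LatticePoints

variable {V : Type*} [NormedAddCommGroup V] [NormedSpace ℝ V]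
  {ι : Type*} [Fintype ι] (Γ : Submodule ℤ V) [DiscreteTopology Γ]

theorem finite_zonotope_inter (e : ι → V) : (zonotope e ∩ (Γ : Set V)).Finite := by
  have : DiscreteTopology Γ.toAddSubgroup := ‹DiscreteTopology Γ›
  have hcl : IsClosed (Γ.toAddSubgroup : Set V) := AddSubgroup.isClosed_of_discrete
  have hd : IsDiscrete (Γ : Set V) := ⟨‹DiscreteTopology Γ›⟩
  exact ((isCompact_zonotope e).inter_right hcl).finite (hd.mono Set.inter_subset_right)

/-- The base is topped by `m` layers of equal cardinality. -/
theorem ncard_zonotope_update [DecidableEq ι] {e : ι → V} {i : ι} (hi : e i ∈ Γ) (k : ι → ℕ)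
    (m : ℕ) :
    (zonotope (fun j => Function.update k i m j • e j) ∩ (Γ : Set V)).ncard =
      (zonotope (fun j => Function.update k i 0 j • e j) ∩ (Γ : Set V)).ncard +
        m * ((zonotope (fun j => Function.update k i 1 j • e j) ∩ (Γ : Set V)) \
          (zonotope (fun j => Function.update k i 0 j • e j) ∩ (Γ : Set V))).ncard := by
  induction m with
  | zero => simp
  | succ m ih =>
    rw [← Set.ncard_sdiff_add_ncard_of_subset
      (Set.inter_subset_inter_left _ (zonotope_update_mono e k i m.le_succ))
      (finite_zonotope_inter Γ _), zonotope_update_succ_diff Γ hi,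
      Set.ncard_image_of_injective _ (add_left_injective _), ih]
    ring

end LatticePoints

/-! ### Interpolation on the vertices of the cube. -/

section Interpolation

variable {ι : Type*} [DecidableEq ι]

/-- A function on `ℕ^ι` that is affine in every variable is recovered from the values at the
points with coordinates `0` and `1`. -/
theorem eq_sum_powerset_of_separately_affine {f : (ι → ℕ) → ℚ}
    (hf : ∀ k i m, f (Function.update k i m) =
      (1 - m) * f (Function.update k i 0) + m * f (Function.update k i 1))
    (s : Finset ι) (k : ι → ℕ) :
    f k = ∑ I ∈ s.powerset, (∏ i ∈ s, if i ∈ I then (k i : ℚ) else 1 - k i) *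
      f (fun i => if i ∈ I then 1 else if i ∈ s then 0 else k i) := by
  induction s using Finset.induction_on with
  | empty => simp
  | insert a s ha ih =>
    rw [Finset.sum_powerset_insert ha, ← Finset.sum_add_distrib, ih]
    refine Finset.sum_congr rfl fun I hI => ?_
    have haI : a ∉ I := fun h => ha (Finset.mem_powerset.1 hI h)
    -- Splitting the variable `a` turns the term of `I` into the terms of `I` and `insert a I`.
    have h1 := hf (fun i => if i ∈ I then 1 else if i ∈ s then 0 else k i) a (k a)
    rw [Function.update_eq_self_iff.2 (by simp [haI, ha])] at h1
    have hne (i : ι) (hi : i ∈ s) : i ≠ a := fun h => ha (h ▸ hi)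
    rw [h1, Finset.prod_insert ha, Finset.prod_insert ha, if_neg haI,
      if_pos (Finset.mem_insert_self a I)]
    have hp : ∏ i ∈ s, (if i ∈ insert a I then (k i : ℚ) else 1 - k i) =
        ∏ i ∈ s, if i ∈ I then (k i : ℚ) else 1 - k i :=
      Finset.prod_congr rfl fun i hi => by simp [hne i hi]
    have e0 : Function.update (fun i => if i ∈ I then 1 else if i ∈ s then 0 else k i) a 0 =
        fun i => if i ∈ I then 1 else if i ∈ insert a s then 0 else k i := by
      ext i
      rcases eq_or_ne i a with rfl | h
      · simp [haI]
      · simp [h]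
    have e1 : Function.update (fun i => if i ∈ I then 1 else if i ∈ s then 0 else k i) a 1 =
        fun i => if i ∈ insert a I then 1 else if i ∈ insert a s then 0 else k i := by
      ext i
      rcases eq_or_ne i a with rfl | h
      · simp
      · simp [h]
    rw [hp, e0, e1]
    ring

variable [Fintype ι]

/-- The polynomial of degree at most one in every variable with value `w I` at the indicator
vector of `I`. -/
noncomputable def cubeInterpolation (w : Finset ι → ℚ) : MvPolynomial ι ℚ :=
  ∑ I, (∏ i, if i ∈ I then MvPolynomial.X i else 1 - MvPolynomial.X i) * MvPolynomial.C (w I)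

theorem aeval_cubeInterpolation {R : Type*} [CommRing R] [Algebra ℚ R] (w : Finset ι → ℚ)
    (x : ι → R) :
    MvPolynomial.aeval x (cubeInterpolation w) =
      ∑ I, (∏ i, if i ∈ I then x i else 1 - x i) * algebraMap ℚ R (w I) := by
  simp [cubeInterpolation, apply_ite (MvPolynomial.aeval x)]

theorem aeval_mul_cubeInterpolation {R : Type*} [CommRing R] [Algebra ℚ R] (w : Finset ι → ℚ)
    (p v : ι → R) :
    MvPolynomial.aeval (fun i => p i * v i) (cubeInterpolation w) =
      ∑ A : Finset ι, (∏ i ∈ A, p i) *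
        MvPolynomial.aeval (fun i => if i ∈ A then v i else 0) (cubeInterpolation w) *
        ∏ i ∈ Aᶜ, (1 - p i) := by
  simp only [aeval_cubeInterpolation, Finset.mul_sum, Finset.sum_mul]
  rw [Finset.sum_comm]
  refine Finset.sum_congr rfl fun I _ => ?_
  -- Each factor is affine in its variable; `Finset.prod_add` then lets `A` collect the indices
  -- where the `p i` summand is chosen.
  have h (i : ι) : (if i ∈ I then p i * v i else 1 - p i * v i) =
      p i * (if i ∈ I then v i else 1 - v i) + (1 - p i) * (if i ∈ I then 0 else 1) := by
    split_ifs <;> ring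
  rw [Finset.prod_congr rfl fun i _ => h i, Finset.prod_add, Finset.powerset_univ,
    Finset.sum_mul]
  refine Finset.sum_congr rfl fun A _ => ?_
  rw [← Finset.prod_mul_prod_compl A
    fun i => if i ∈ I then (if i ∈ A then v i else 0) else 1 - if i ∈ A then v i else 0]
  have h1 : ∏ i ∈ A, (if i ∈ I then (if i ∈ A then v i else 0) else 1 - if i ∈ A then v i else 0) =
      ∏ i ∈ A, if i ∈ I then v i else 1 - v i :=
    Finset.prod_congr rfl fun i hi => by simp [hi]
  have h2 : ∏ i ∈ Aᶜ,
      (if i ∈ I then (if i ∈ A then v i else 0) else 1 - if i ∈ A then v i else 0) =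
      ∏ i ∈ Aᶜ, if i ∈ I then 0 else 1 :=
    Finset.prod_congr rfl fun i hi => by simp [Finset.mem_compl.1 hi]
  rw [h1, h2, Finset.prod_mul_distrib, Finset.prod_mul_distrib, ← Finset.compl_eq_univ_sdiff]
  ring

end Interpolation

/-! ### Ehrhart polynomials of zonotopes and cubes. -/

section Ehrhart

theorem IsMultivariateEhrhart.multivariateEhrhart_eq {V : Type*} [AddCommGroup V] [Module ℝ V]
    {ι : Type*} [Fintype ι] {Γ : Submodule ℤ V} {e : ι → V} {f : MvPolynomial ι ℚ}
    (hf : IsMultivariateEhrhart Γ e f) : multivariateEhrhart Γ e = f := by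
  have h : ∃ f, IsMultivariateEhrhart Γ e f := ⟨f, hf⟩
  rw [multivariateEhrhart, dif_pos h]
  exact h.choose_spec.unique hf

theorem IsEhrhart.ehrhart_eq {V : Type*} [AddCommGroup V] [Module ℝ V] {Γ : Submodule ℤ V}
    {P : Set V} {f : Polynomial ℚ} (hf : IsEhrhart Γ P f) : ehrhart Γ P = f := by
  have h : ∃ f, IsEhrhart Γ P f := ⟨f, hf⟩
  rw [ehrhart, dif_pos h]
  exact h.choose_spec.unique hf

/-- The Ehrhart polynomial of a zonotope is the diagonal of the multivariate one. -/
theorem IsMultivariateEhrhart.isEhrhart {V : Type*} [AddCommGroup V] [Module ℝ V]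
    {ι : Type*} [Fintype ι] {Γ : Submodule ℤ V} {e : ι → V} {f : MvPolynomial ι ℚ}
    (hf : IsMultivariateEhrhart Γ e f) :
    IsEhrhart Γ (zonotope e) (MvPolynomial.aeval (fun _ => Polynomial.X) f) := by
  intro k hk
  rw [smul_zonotope]
  refine ⟨(hf (fun _ => k) fun _ => hk).1, ?_⟩
  rw [← (hf (fun _ => k) fun _ => hk).2, ← Polynomial.coe_aeval_eq_eval,
    MvPolynomial.comp_aeval_apply]
  simp only [Polynomial.aeval_X]
  rw [← MvPolynomial.coe_aeval_eq_eval]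
  rfl

theorem aeval_aeval_X {ι R : Type*} [CommRing R] [Algebra ℚ R] (f : MvPolynomial ι ℚ) (x : R) :
    Polynomial.aeval x (MvPolynomial.aeval (fun _ : ι => (Polynomial.X : Polynomial ℚ)) f) =
      MvPolynomial.aeval (fun _ => x) f := by
  rw [MvPolynomial.comp_aeval_apply]
  simp

variable {ι : Type*} [Fintype ι] [DecidableEq ι]

section Lattice

variable {V : Type*} [NormedAddCommGroup V] [NormedSpace ℝ V]

/-- The polynomial that interpolates the numbers of lattice points of the zonotopes of the
sublists of `e`. -/
noncomputable def zonotopePolynomial (Γ : Submodule ℤ V) (e : ι → V) : MvPolynomial ι ℚ :=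
  cubeInterpolation fun I =>
    (zonotope (fun i => (if i ∈ I then 1 else 0 : ℕ) • e i) ∩ (Γ : Set V)).ncard

variable (Γ : Submodule ℤ V) [DiscreteTopology Γ] {e : ι → V}

/-- Zero multiplicities are included, beyond what `IsMultivariateEhrhart` demands; sublists need
them. -/
theorem eval_zonotopePolynomial (he : ∀ i, e i ∈ Γ) (k : ι → ℕ) :
    MvPolynomial.eval (fun i => (k i : ℚ)) (zonotopePolynomial Γ e) =
      (zonotope (fun i => k i • e i) ∩ (Γ : Set V)).ncard := by
  have h := eq_sum_powerset_of_separately_affine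
    (f := fun k => ((zonotope (fun i => k i • e i) ∩ (Γ : Set V)).ncard : ℚ)) ?_ Finset.univ k
  · rw [h, ← MvPolynomial.coe_aeval_eq_eval]
    change MvPolynomial.aeval _ _ = _
    rw [zonotopePolynomial, aeval_cubeInterpolation]
    simp
  · intro k i m
    have h1 := ncard_zonotope_update Γ (he i) k 1
    rw [ncard_zonotope_update Γ (he i) k m, h1]
    push_cast
    ring

theorem isMultivariateEhrhart_zonotopePolynomial (he : ∀ i, e i ∈ Γ) :
    IsMultivariateEhrhart Γ e (zonotopePolynomial Γ e) :=
  fun k _ => ⟨finite_zonotope_inter Γ _, eval_zonotopePolynomial Γ he k⟩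

/-- A generator of multiplicity zero contributes nothing, so omitting it amounts to setting its
variable to zero. -/
theorem isMultivariateEhrhart_sublist (he : ∀ i, e i ∈ Γ) (A : Finset ι) :
    IsMultivariateEhrhart Γ (sublist e A)
      (MvPolynomial.aeval (fun i => if h : i ∈ A then MvPolynomial.X ⟨i, h⟩ else 0)
        (zonotopePolynomial Γ e)) := by
  intro k _
  refine ⟨finite_zonotope_inter Γ _, ?_⟩
  rw [← zonotope_extend, ← eval_zonotopePolynomial Γ he, ← MvPolynomial.coe_aeval_eq_eval,
    ← MvPolynomial.coe_aeval_eq_eval]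
  change MvPolynomial.aeval _ _ = MvPolynomial.aeval _ _
  rw [MvPolynomial.comp_aeval_apply]
  congr 2
  ext i
  by_cases h : i ∈ A <;> simp [h]

theorem aeval_multivariateEhrhart_sublist (he : ∀ i, e i ∈ Γ) (A : Finset ι)
    {R : Type*} [CommRing R] [Algebra ℚ R] (v : ι → R) :
    MvPolynomial.aeval (fun i : A => v i) (multivariateEhrhart Γ (sublist e A)) =
      MvPolynomial.aeval (fun i => if i ∈ A then v i else 0) (zonotopePolynomial Γ e) := by
  rw [(isMultivariateEhrhart_sublist Γ he A).multivariateEhrhart_eq,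
    MvPolynomial.comp_aeval_apply]
  congr 2
  ext i
  by_cases h : i ∈ A <;> simp [h]

end Lattice

theorem mem_intLattice {x : ι → ℝ} : x ∈ intLattice ι ↔ ∀ i, ∃ z : ℤ, (z : ℝ) = x i := by
  have h : Set.range (stdList ι) = Set.range (Pi.basisFun ℝ ι) := by
    congr 1
    ext i
    simp [stdList]
  rw [intLattice, h, Module.Basis.mem_span_iff_repr_mem]
  simp

theorem zonotope_stdList_inter_intLattice (k : ι → ℕ) :
    zonotope (fun i => k i • stdList ι i) ∩ (intLattice ι : Set (ι → ℝ)) =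
      (fun (a : ι → ℕ) i => (a i : ℝ)) ''
        (Fintype.piFinset fun i => Finset.range (k i + 1) : Finset (ι → ℕ)) := by
  ext x
  simp only [Set.mem_inter_iff, mem_zonotope_nsmul, sum_smul_stdList, SetLike.mem_coe, mem_intLattice,
    Set.mem_image, Fintype.mem_piFinset, Finset.mem_range]
  constructor
  · rintro ⟨⟨l, hl, rfl⟩, hx⟩
    choose z hz using hx
    have hz0 (i : ι) : 0 ≤ z i := by
      have := (hl i).1
      rw [← hz] at this
      exact_mod_cast this
    refine ⟨fun i => (z i).toNat, fun i => ?_, ?_⟩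
    · have := (hl i).2
      rw [← hz] at this
      have h2 : z i ≤ k i := by exact_mod_cast this
      dsimp only
      omega
    · ext i
      rw [← hz i]
      exact_mod_cast Int.toNat_of_nonneg (hz0 i)
  · rintro ⟨a, ha, rfl⟩
    refine ⟨⟨_, fun i => ⟨Nat.cast_nonneg _, ?_⟩, rfl⟩, fun i => ⟨a i, by simp⟩⟩
    exact_mod_cast Nat.lt_succ_iff.1 (ha i)

/-- The zonotope is the box `∏ [0, k i]`, with `k i + 1` integers on each axis. -/
theorem isMultivariateEhrhart_stdList :
    IsMultivariateEhrhart (intLattice ι) (stdList ι) (∏ i, (1 + MvPolynomial.X i)) := by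
  intro k _
  rw [zonotope_stdList_inter_intLattice]
  refine ⟨(Finset.finite_toSet _).image _, ?_⟩
  rw [Set.ncard_image_of_injective, Set.ncard_coe_finset, Fintype.card_piFinset]
  · simp [add_comm]
  · intro a b h
    ext i
    exact Nat.cast_injective (congrFun h i)

end Ehrhart

/-! ### The multivariate and univariate formulas. -/

theorem theorem3p9 {n : ℕ} (Γ : Submodule ℤ (Fin n → ℝ)) [DiscreteTopology Γ]
    {ι : Type*} [Fintype ι] [DecidableEq ι] (e : ι → (Fin n → ℝ)) (he : ∀ i, e i ∈ Γ)
    (R : Type*) [CommRing R] [Algebra ℚ R] :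
    -- all the polynomials that occur below exist, with their defining property
    (IsMultivariateEhrhart Γ e (multivariateEhrhart Γ e) ∧
      IsEhrhart Γ (zonotope e) (ehrhart Γ (zonotope e)) ∧
      ∀ A : Finset ι,
        IsMultivariateEhrhart Γ (sublist e A) (multivariateEhrhart Γ (sublist e A)) ∧
        IsMultivariateEhrhart (intLattice ↥(Aᶜ)) (stdList ↥(Aᶜ))
          (multivariateEhrhart (intLattice ↥(Aᶜ)) (stdList ↥(Aᶜ))) ∧
        IsEhrhart Γ (zonotope (sublist e A)) (ehrhart Γ (zonotope (sublist e A))) ∧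
        IsEhrhart (intLattice ↥(Aᶜ)) (unitCube ↥(Aᶜ))
          (ehrhart (intLattice ↥(Aᶜ)) (unitCube ↥(Aᶜ)))) ∧
    -- the multivariate formula
    (∀ p v : ι → R,
      MvPolynomial.aeval (fun i => p i * v i) (multivariateEhrhart Γ e) =
        ∑ A : Finset ι, (∏ i ∈ A, p i) *
          MvPolynomial.aeval (fun i : ↥A => v i) (multivariateEhrhart Γ (sublist e A)) *
          MvPolynomial.aeval (fun i : ↥(Aᶜ) => -p i)
            (multivariateEhrhart (intLattice ↥(Aᶜ)) (stdList ↥(Aᶜ)))) ∧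
    -- the univariate formula
    (∀ p t : R,
      Polynomial.aeval (p * t) (ehrhart Γ (zonotope e)) =
        ∑ A : Finset ι, p ^ A.card *
          Polynomial.aeval t (ehrhart Γ (zonotope (sublist e A))) *
          Polynomial.aeval (-p) (ehrhart (intLattice ↥(Aᶜ)) (unitCube ↥(Aᶜ)))) := by
  have hE := isMultivariateEhrhart_zonotopePolynomial Γ he
  have hA (A : Finset ι) : IsMultivariateEhrhart Γ (sublist e A)
      (multivariateEhrhart Γ (sublist e A)) := by
    rw [(isMultivariateEhrhart_sublist Γ he A).multivariateEhrhart_eq]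
    exact isMultivariateEhrhart_sublist Γ he A
  have hC (A : Finset ι) := isMultivariateEhrhart_stdList (ι := ↥(Aᶜ))
  have hQ (A : Finset ι) : IsEhrhart (intLattice ↥(Aᶜ)) (unitCube ↥(Aᶜ))
      (MvPolynomial.aeval (fun _ => Polynomial.X) (∏ i : ↥(Aᶜ), (1 + MvPolynomial.X i) : MvPolynomial ↥(Aᶜ) ℚ)) := by
    rw [← zonotope_stdList]
    exact (hC A).isEhrhart
  have main : ∀ p v : ι → R,
      MvPolynomial.aeval (fun i => p i * v i) (multivariateEhrhart Γ e) =
        ∑ A : Finset ι, (∏ i ∈ A, p i) *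
          MvPolynomial.aeval (fun i : ↥A => v i) (multivariateEhrhart Γ (sublist e A)) *
          MvPolynomial.aeval (fun i : ↥(Aᶜ) => -p i)
            (multivariateEhrhart (intLattice ↥(Aᶜ)) (stdList ↥(Aᶜ))) := by
    intro p v
    rw [hE.multivariateEhrhart_eq, zonotopePolynomial, aeval_mul_cubeInterpolation]
    refine Finset.sum_congr rfl fun A _ => ?_
    rw [aeval_multivariateEhrhart_sublist Γ he, (hC A).multivariateEhrhart_eq, zonotopePolynomial,
      ← Finset.prod_coe_sort Aᶜ]
    simp [sub_eq_add_neg]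
  refine ⟨⟨?_, ?_, fun A => ⟨hA A, ?_, ?_, ?_⟩⟩, main, fun p t => ?_⟩
  · rw [hE.multivariateEhrhart_eq]
    exact hE
  · rw [hE.isEhrhart.ehrhart_eq]
    exact hE.isEhrhart
  · rw [(hC A).multivariateEhrhart_eq]
    exact hC A
  · rw [(hA A).isEhrhart.ehrhart_eq]
    exact (hA A).isEhrhart
  · rw [(hQ A).ehrhart_eq]
    exact hQ A
  -- Constant families restrict the multivariate formula to the diagonal.
  · have h := main (fun _ => p) (fun _ => t)
    rw [hE.multivariateEhrhart_eq] at h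
    rw [hE.isEhrhart.ehrhart_eq, aeval_aeval_X, h]
    refine Finset.sum_congr rfl fun A _ => ?_
    rw [(hA A).isEhrhart.ehrhart_eq, aeval_aeval_X, (hQ A).ehrhart_eq, aeval_aeval_X,
      (hC A).multivariateEhrhart_eq, Finset.prod_const]
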